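/- Let $\mathcal F^2$ be the Fock space of entire functions $f$ with $\|f\|^2=\frac1\pi\int_{\mathbb C}|f(z)|^2e^{-|z|^2}\,dV(z)<\infty$, where $dV$ is Lebesgue measure on $\mathbb C$, with the corresponding inner product. Let $\psi,\varphi$ be entire functions with $\psi\not\equiv 0$ and $\varphi$ nonconstant. The maximal weighted composition operator $W_{\psi,\varphi,\max}$ has domain $\{f\in\mathcal F^2:\psi\cdot(f\circ\varphi)\in\mathcal F^2\}$ and maps $f$ to $\psi\cdot (f\circ\varphi)$. Let $W_{\psi,\varphi}$ be a densely defined (not necessarily bounded) weighted composition operator, i.e. the restriction of $W_{\psi,\varphi,\max}$ to a dense linear subspace $\operatorname{dom}(W_{\psi,\varphi})$ of $\mathcal F^2$ contained in $\operatorname{dom}(W_{\psi,\varphi,\max})$. Suppose that there is a mapping $S:\mathcal F^2\to\mathcal F^2$ with $S(Sf)=f$ for all $f\in\mathcal F^2$ (no linearity or continuity is assumed) such that, with $\operatorname{dom}(W_{\psi,\varphi}S)=\{f\in\mathcal F^2: Sf\in\operatorname{dom}(W_{\psi,\varphi})\}$, $$\operatorname{dom}(W_{\psi,\varphi}^*)\subseteq\operatorname{dom}(W_{\psi,\varphi}S)\quad\text{and}\quad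 \|W_{\psi,\varphi}Sf\|\le\|W_{\psi,\varphi}^*f\|\quad\text{for all } f\in\operatorname{dom}(W_{\psi,\varphi}^*).$$ Then: 1. $\psi(z)\neq0$ for every $z\in\mathbb C$. Furthermore, if $\psi\in\mathcal F^2$, then there are constants $C,D\in\mathbb C$ with $|C|<1/2$ such that $\psi(z)=\psi(0)e^{Cz^2+Dz}$ for all $z\in\mathbb C$, and $\psi(0)\ne 0$. 2. There are constants $A,B\in\mathbb C$ with $A\neq0$ such that $\varphi(z)=Az+B$ for all $z\in\mathbb C$. 3. If $A=1$ and $S$ is the identity operator, then there is a constant $D\in\mathbb C$ such that $\psi(z)=\psi(0)e^{Dz}$ for all $z\in\mathbb C$, where $\psi(0)\ne0$ and $|B|\ge|D|$. -/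

import Mathlib

open MeasureTheory Filter Topology Complex
open scoped ENNReal LinearPMap ComplexConjugate

noncomputable section

/-- The Gaussian measure `π⁻¹ e^{-|z|²} dV(z)` on `ℂ`, where `dV` is Lebesgue measure. -/
def gaussMeasure : Measure ℂ :=
  (volume : Measure ℂ).withDensity fun z => ENNReal.ofReal (Real.exp (-‖z‖ ^ 2) / Real.pi)

/-- The entire functions that are square integrable with respect to the Gaussian measure,
as a subspace of the space of all functions `ℂ → ℂ`. -/
def fockSubmodule : Submodule ℂ (ℂ → ℂ) where
  carrier := {f | Differentiable ℂ f ∧ MemLp f 2 gaussMeasure}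
  zero_mem' := ⟨differentiable_const 0, MemLp.zero⟩
  add_mem' hf hg := ⟨hf.1.add hg.1, hf.2.add hg.2⟩
  smul_mem' c _ hf := ⟨hf.1.const_smul c, hf.2.const_smul c⟩

/-- The Fock space `F²`. Its elements are honest functions `ℂ → ℂ`. It is a type synonym, so that it
carries the topology of the `L²`-norm below and not that of pointwise convergence. -/
def FockSpace : Type := fockSubmodule

namespace FockSpace

instance : AddCommGroup FockSpace := inferInstanceAs (AddCommGroup fockSubmodule)

instance : Module ℂ FockSpace := inferInstanceAs (Module ℂ fockSubmodule)

/-- The element of the Fock space given by an entire square integrable function. -/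
def mk (f : ℂ → ℂ) (hf : f ∈ fockSubmodule) : FockSpace := ⟨f, hf⟩

/-- The function underlying an element of the Fock space. -/
def toFun (f : FockSpace) : ℂ → ℂ := Subtype.val f

instance : CoeFun FockSpace fun _ => ℂ → ℂ := ⟨toFun⟩

theorem mem (f : FockSpace) : (f : ℂ → ℂ) ∈ fockSubmodule := Subtype.property f

theorem differentiable (f : FockSpace) : Differentiable ℂ f := f.mem.1

theorem memLp (f : FockSpace) : MemLp f 2 gaussMeasure := f.mem.2

theorem ext' {f g : FockSpace} (h : ∀ z, f z = g z) : f = g := Subtype.ext (funext h)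

@[simp] theorem mk_apply (f : ℂ → ℂ) (hf : f ∈ fockSubmodule) (z : ℂ) : mk f hf z = f z := rfl

@[simp] theorem zero_apply (z : ℂ) : (0 : FockSpace) z = 0 := rfl

@[simp] theorem add_apply (f g : FockSpace) (z : ℂ) : (f + g) z = f z + g z := rfl

@[simp] theorem sub_apply (f g : FockSpace) (z : ℂ) : (f - g) z = f z - g z := rfl

@[simp] theorem smul_apply (c : ℂ) (f : FockSpace) (z : ℂ) : (c • f) z = c * f z := rfl

/-- The element of `L²` defined by an element of the Fock space. -/
def toL2 : FockSpace →ₗ[ℂ] Lp ℂ 2 gaussMeasure where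
  toFun f := f.memLp.toLp f
  map_add' f g := MemLp.toLp_add f.memLp g.memLp
  map_smul' c f := MemLp.toLp_const_smul c f.memLp

theorem coeFn_toL2 (f : FockSpace) : toL2 f =ᵐ[gaussMeasure] f := f.memLp.coeFn_toLp

theorem volume_absolutelyContinuous : (volume : Measure ℂ) ≪ gaussMeasure := by
  refine withDensity_absolutelyContinuous' (by fun_prop) (ae_of_all _ fun z => ?_)
  have : 0 < Real.exp (-‖z‖ ^ 2) / Real.pi := by positivity
  simpa using this

theorem toL2_eq_zero {f : FockSpace} (h : toL2 f = 0) : f = 0 := by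
  have h1 : (f : ℂ → ℂ) =ᵐ[gaussMeasure] fun _ => 0 := by
    filter_upwards [coeFn_toL2 f, Lp.coeFn_zero ℂ 2 gaussMeasure] with z h1 h2
    rw [← h1, h, h2, Pi.zero_apply]
  have h2 := (Continuous.ae_eq_iff_eq volume f.differentiable.continuous continuous_const).1
    (volume_absolutelyContinuous.ae_eq h1)
  exact ext' fun z => congrFun h2 z

/-- The inner product `∫ conj (f z) * g z dμ(z)`, with `μ` the Gaussian measure; as everywhere in
Mathlib, it is conjugate-linear in the first variable. -/
def innerProd (f g : FockSpace) : ℂ := ∫ z, conj (f z) * g z ∂gaussMeasure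

theorem innerProd_eq (f g : FockSpace) : innerProd f g = inner ℂ (toL2 f) (toL2 g) := by
  rw [L2.inner_def, innerProd]
  refine integral_congr_ae ?_
  filter_upwards [coeFn_toL2 f, coeFn_toL2 g] with z h1 h2
  rw [h1, h2, RCLike.inner_apply, mul_comm]

/-- The inner product structure of the Fock space. -/
@[reducible] def core : InnerProductSpace.Core ℂ FockSpace where
  inner := innerProd
  conj_inner_symm f g := by
    change conj (innerProd g f) = innerProd f g
    rw [innerProd_eq, innerProd_eq, inner_conj_symm]
  re_inner_nonneg f := by
    rw [innerProd_eq]; exact inner_self_nonneg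
  add_left f g h := by
    change innerProd (f + g) h = innerProd f h + innerProd g h
    rw [innerProd_eq, innerProd_eq, innerProd_eq, map_add, inner_add_left]
  smul_left f g r := by
    change innerProd (r • f) g = conj r * innerProd f g
    rw [innerProd_eq, innerProd_eq, map_smul, inner_smul_left]
  definite f hf := by
    change innerProd f f = 0 at hf
    rw [innerProd_eq, inner_self_eq_zero] at hf
    exact toL2_eq_zero hf

instance : NormedAddCommGroup FockSpace := core.toNormedAddCommGroup

instance : InnerProductSpace ℂ FockSpace := InnerProductSpace.ofCore core.toCore

theorem inner_eq_integral (f g : FockSpace) :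
    inner ℂ f g = ∫ z, conj (f z) * g z ∂gaussMeasure := rfl

theorem norm_toL2 (f : FockSpace) : ‖toL2 f‖ = ‖f‖ := by
  rw [@norm_eq_sqrt_re_inner ℂ, @norm_eq_sqrt_re_inner ℂ, ← innerProd_eq]
  rfl

theorem enorm_eq_eLpNorm (f : FockSpace) : ENNReal.ofReal ‖f‖ = eLpNorm f 2 gaussMeasure := by
  rw [← norm_toL2, Lp.norm_def, ENNReal.ofReal_toReal (Lp.eLpNorm_ne_top _)]
  exact eLpNorm_congr_ae (coeFn_toL2 f)

/-- Sub-mean value inequality on the unit disc. -/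
theorem pi_mul_enorm_le {f : ℂ → ℂ} (hf : Differentiable ℂ f) (z : ℂ) :
    ENNReal.ofReal Real.pi * ‖f z‖ₑ ≤ ∫⁻ w in Metric.ball z 1, ‖f w‖ₑ := by
  have hc : Continuous f := hf.continuous
  have hpi := Real.pi_pos
  have hcirc : ∀ r : ℝ, ENNReal.ofReal (2 * Real.pi) * ‖f z‖ₑ ≤
      ∫⁻ θ in Set.Ioo (-Real.pi) Real.pi, ‖f (r * (Real.cos θ + Real.sin θ * I) + z)‖ₑ := by
    intro r
    have h1 : Real.circleAverage f z r = f z :=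
      DiffContOnCl.circleAverage hf.diffContOnCl
    rw [Real.circleAverage_eq_integral_add (-Real.pi),
      intervalIntegral.integral_comp_add_right (fun θ => f (circleMap z r θ)),
      intervalIntegral.integral_of_le (by linarith)] at h1
    have h2 : (2 * Real.pi : ℝ) • f z =
        ∫ θ in Set.Ioc (0 + -Real.pi) (2 * Real.pi + -Real.pi), f (circleMap z r θ) := by
      rw [← h1, smul_smul, mul_inv_cancel₀ (by positivity), one_smul]
    have h3 : ENNReal.ofReal (2 * Real.pi) * ‖f z‖ₑ = ‖(2 * Real.pi : ℝ) • f z‖ₑ := by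
      rw [enorm_smul, Real.enorm_eq_ofReal (by positivity)]
    rw [h3, h2]
    refine (enorm_integral_le_lintegral_enorm _).trans (le_of_eq ?_)
    have e1 : 0 + -Real.pi = -Real.pi := by ring
    have e2 : 2 * Real.pi + -Real.pi = Real.pi := by ring
    rw [e1, e2, ← restrict_Ioo_eq_restrict_Ioc]
    refine lintegral_congr fun θ => ?_
    simp only [circleMap, Complex.exp_mul_I, Complex.ofReal_cos, Complex.ofReal_sin]
    rw [add_comm]
  have hmeas : Measurable fun w : ℂ => (Metric.ball (0 : ℂ) 1).indicator
      (fun w => ‖f (w + z)‖ₑ) w := by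
    refine Measurable.indicator ?_ Metric.isOpen_ball.measurableSet
    exact (hc.comp (continuous_id.add continuous_const)).enorm.measurable
  have hsymm : Measurable fun p : ℝ × ℝ => Complex.polarCoord.symm p := by
    simp only [Complex.polarCoord_symm_apply]
    fun_prop
  have htrans : ∫⁻ w in Metric.ball z 1, ‖f w‖ₑ =
      ∫⁻ w, (Metric.ball (0 : ℂ) 1).indicator (fun w => ‖f (w + z)‖ₑ) w := by
    rw [← lintegral_indicator Metric.isOpen_ball.measurableSet,
      ← lintegral_add_right_eq_self _ z]
    refine lintegral_congr fun w => ?_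
    by_cases hw : w ∈ Metric.ball (0 : ℂ) 1
    · rw [Set.indicator_of_mem hw, Set.indicator_of_mem]
      simpa using hw
    · rw [Set.indicator_of_notMem hw, Set.indicator_of_notMem]
      simpa using hw
  rw [htrans, ← Complex.lintegral_comp_polarCoord_symm]
  have htarget : polarCoord.target = Set.Ioi (0 : ℝ) ×ˢ Set.Ioo (-Real.pi) Real.pi := rfl
  rw [htarget, Measure.volume_eq_prod, ← Measure.prod_restrict, lintegral_prod _ (by
    refine Measurable.aemeasurable ?_
    exact (ENNReal.measurable_ofReal.comp measurable_fst).smul (hmeas.comp hsymm))]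
  have hhalf : ∫⁻ r in Set.Ioo (0 : ℝ) 1, ENNReal.ofReal r = ENNReal.ofReal (1 / 2) := by
    rw [← ofReal_integral_eq_lintegral_ofReal, restrict_Ioo_eq_restrict_Ioc,
      ← intervalIntegral.integral_of_le zero_le_one, integral_id]
    · norm_num
    · exact (continuous_id.integrableOn_Icc (a := 0) (b := 1)).mono_set Set.Ioo_subset_Icc_self
    · filter_upwards [ae_restrict_mem measurableSet_Ioo] with r hr using hr.1.le
  calc ENNReal.ofReal Real.pi * ‖f z‖ₑ
      = ENNReal.ofReal (1 / 2) * (ENNReal.ofReal (2 * Real.pi) * ‖f z‖ₑ) := by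
        rw [← mul_assoc, ← ENNReal.ofReal_mul (by norm_num)]
        congr 2
        ring
    _ = ∫⁻ r in Set.Ioo (0 : ℝ) 1,
          ENNReal.ofReal r * (ENNReal.ofReal (2 * Real.pi) * ‖f z‖ₑ) := by
        rw [lintegral_mul_const _ ENNReal.measurable_ofReal, hhalf]
    _ ≤ ∫⁻ r in Set.Ioo (0 : ℝ) 1, ∫⁻ θ in Set.Ioo (-Real.pi) Real.pi,
          ENNReal.ofReal (r, θ).1 • (Metric.ball (0 : ℂ) 1).indicator (fun w => ‖f (w + z)‖ₑ)
            (Complex.polarCoord.symm (r, θ)) := by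
        refine setLIntegral_mono' measurableSet_Ioo fun r hr => ?_
        simp only [smul_eq_mul]
        rw [lintegral_const_mul' _ _ ENNReal.ofReal_ne_top]
        gcongr
        refine (hcirc r).trans (le_of_eq ?_)
        refine lintegral_congr fun θ => ?_
        rw [Set.indicator_of_mem, Complex.polarCoord_symm_apply]
        rw [mem_ball_zero_iff, Complex.norm_polarCoord_symm, abs_of_pos hr.1]
        exact hr.2
    _ ≤ _ := lintegral_mono_set Set.Ioo_subset_Ioi_self

/-- On bounded sets, Lebesgue measure is dominated by the Gaussian measure. -/
theorem exists_restrict_le (R : ℝ) : ∃ c : ℝ, 0 < c ∧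
    (volume : Measure ℂ).restrict (Metric.ball 0 R) ≤ ENNReal.ofReal c • gaussMeasure := by
  refine ⟨Real.exp (R ^ 2) * Real.pi, by positivity, ?_⟩
  refine Measure.le_iff.2 fun s hs => ?_
  rw [Measure.restrict_apply hs, Measure.smul_apply, gaussMeasure, withDensity_apply _ hs,
    smul_eq_mul, ← lintegral_const_mul' _ _ ENNReal.ofReal_ne_top]
  calc volume (s ∩ Metric.ball 0 R) = ∫⁻ _ in s ∩ Metric.ball 0 R, 1 := by simp
    _ ≤ ∫⁻ z in s ∩ Metric.ball 0 R, ENNReal.ofReal (Real.exp (R ^ 2) * Real.pi) *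
          ENNReal.ofReal (Real.exp (-‖z‖ ^ 2) / Real.pi) := by
        refine setLIntegral_mono' (hs.inter Metric.isOpen_ball.measurableSet) fun z hz => ?_
        rw [← ENNReal.ofReal_mul (by positivity), ← ENNReal.ofReal_one]
        refine ENNReal.ofReal_le_ofReal ?_
        have h1 : Real.exp (R ^ 2) * Real.pi * (Real.exp (-‖z‖ ^ 2) / Real.pi) =
            Real.exp (R ^ 2 + -‖z‖ ^ 2) := by
          rw [Real.exp_add]
          field_simp
        rw [h1]
        refine Real.one_le_exp ?_
        have h2 : ‖z‖ < R := by simpa using hz.2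
        nlinarith [norm_nonneg z]
    _ ≤ _ := lintegral_mono_set Set.inter_subset_left

/-- Point evaluations are bounded, uniformly on bounded sets. -/
theorem exists_norm_apply_le (R : ℝ) : ∃ C : ℝ, ∀ (f : FockSpace) (z : ℂ), ‖z‖ ≤ R →
    ‖f z‖ ≤ C * ‖f‖ := by
  obtain ⟨c, hc, hle⟩ := exists_restrict_le (R + 1)
  have hfin : ∃ K : ℝ≥0∞, K ≠ ∞ ∧ ∀ (f : FockSpace) (z : ℂ), ‖z‖ ≤ R →
      ENNReal.ofReal Real.pi * ‖f z‖ₑ ≤ K * ENNReal.ofReal ‖f‖ := by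
    refine ⟨ENNReal.ofReal c ^ (1 / (2 : ℝ≥0∞)).toReal *
      ((volume : Measure ℂ).restrict (Metric.ball 0 (R + 1))) Set.univ ^
        (1 / (1 : ℝ≥0∞).toReal - 1 / (2 : ℝ≥0∞).toReal), ?_, fun f z hz => ?_⟩
    · refine ENNReal.mul_ne_top ?_ ?_
      · exact ENNReal.rpow_ne_top_of_nonneg (by norm_num) ENNReal.ofReal_ne_top
      · refine ENNReal.rpow_ne_top_of_nonneg (by norm_num) ?_
        rw [Measure.restrict_apply_univ]
        exact measure_ball_lt_top.ne
    · have hsub : Metric.ball z 1 ⊆ Metric.ball 0 (R + 1) :=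
        Metric.ball_subset_ball' (by rw [dist_zero_right]; linarith)
      calc ENNReal.ofReal Real.pi * ‖f z‖ₑ
          ≤ ∫⁻ w in Metric.ball z 1, ‖f w‖ₑ := pi_mul_enorm_le f.differentiable z
        _ ≤ ∫⁻ w in Metric.ball 0 (R + 1), ‖f w‖ₑ := lintegral_mono_set hsub
        _ = eLpNorm f 1 (volume.restrict (Metric.ball 0 (R + 1))) :=
            eLpNorm_one_eq_lintegral_enorm.symm
        _ ≤ eLpNorm f 2 (volume.restrict (Metric.ball 0 (R + 1))) * _ :=
            eLpNorm_le_eLpNorm_mul_rpow_measure_univ (by norm_num)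
              f.differentiable.continuous.aestronglyMeasurable
        _ ≤ eLpNorm f 2 (ENNReal.ofReal c • gaussMeasure) * _ := by
            gcongr
        _ = _ := by
            rw [eLpNorm_smul_measure_of_ne_top (by norm_num), ← enorm_eq_eLpNorm, smul_eq_mul,
              mul_right_comm]
  obtain ⟨K, hK, h⟩ := hfin
  refine ⟨K.toReal / Real.pi, fun f z hz => ?_⟩
  have h1 := ENNReal.toReal_mono (ENNReal.mul_ne_top hK ENNReal.ofReal_ne_top) (h f z hz)
  rw [ENNReal.toReal_mul, ENNReal.toReal_mul, ENNReal.toReal_ofReal Real.pi_pos.le,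
    ENNReal.toReal_ofReal (norm_nonneg _), toReal_enorm] at h1
  rw [div_mul_eq_mul_div, le_div_iff₀ Real.pi_pos, mul_comm]
  exact h1

instance : CompleteSpace FockSpace := by
  refine Metric.complete_of_cauchySeq_tendsto fun u hu => ?_
  have hLp : CauchySeq fun n => toL2 (u n) := by
    rw [Metric.cauchySeq_iff] at hu ⊢
    simpa only [dist_eq_norm, ← map_sub, norm_toL2] using hu
  obtain ⟨g, hg⟩ := cauchySeq_tendsto_of_complete hLp
  have hunif : ∀ R : ℝ, UniformCauchySeqOn (fun n => (u n : ℂ → ℂ)) atTop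
      (Metric.closedBall 0 R) := by
    intro R
    obtain ⟨C, hC⟩ := exists_norm_apply_le R
    rw [Metric.uniformCauchySeqOn_iff]
    intro ε hε
    obtain ⟨N, hN⟩ := Metric.cauchySeq_iff.1 hu (ε / (|C| + 1)) (by positivity)
    refine ⟨N, fun m hm n hn z hz => ?_⟩
    have h1 := hC (u m - u n) z (by simpa using hz)
    have h2 := hN m hm n hn
    rw [dist_eq_norm, lt_div_iff₀ (by positivity)] at h2
    rw [dist_eq_norm, ← sub_apply]
    have h3 : C * ‖u m - u n‖ ≤ |C| * ‖u m - u n‖ :=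
      mul_le_mul_of_nonneg_right (le_abs_self C) (norm_nonneg _)
    nlinarith [norm_nonneg (u m - u n)]
  have hpt : ∀ z : ℂ, ∃ w, Tendsto (fun n => u n z) atTop (𝓝 w) := fun z =>
    cauchySeq_tendsto_of_complete ((hunif ‖z‖).cauchySeq (x := z) (by simp))
  choose F hF using hpt
  have hloc : TendstoLocallyUniformlyOn (fun n => (u n : ℂ → ℂ)) F atTop Set.univ := by
    rw [tendstoLocallyUniformlyOn_iff_forall_isCompact isOpen_univ]
    intro K _ hK
    obtain ⟨R, hR⟩ := hK.isBounded.subset_closedBall (0 : ℂ)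
    exact ((hunif R).tendstoUniformlyOn_of_tendsto fun z _ => hF z).mono hR
  have hdiff : Differentiable ℂ F := by
    rw [← differentiableOn_univ]
    exact hloc.differentiableOn (Eventually.of_forall fun n => (u n).differentiable.differentiableOn)
      isOpen_univ
  have hae : F =ᵐ[gaussMeasure] g := by
    obtain ⟨ns, hns, hlim⟩ := (tendstoInMeasure_of_tendsto_Lp hg).exists_seq_tendsto_ae
    have hall : ∀ᵐ z ∂gaussMeasure, ∀ n, toL2 (u n) z = u n z :=
      ae_all_iff.2 fun n => coeFn_toL2 (u n)
    filter_upwards [hlim, hall] with z h1 h2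
    simp only [h2] at h1
    exact tendsto_nhds_unique ((hF z).comp hns.tendsto_atTop) h1
  let G : FockSpace := mk F ⟨hdiff, (memLp_congr_ae hae).2 (Lp.memLp g)⟩
  have hG : toL2 G = g := Lp.ext ((coeFn_toL2 G).trans hae)
  refine ⟨G, ?_⟩
  rw [tendsto_iff_norm_sub_tendsto_zero] at hg ⊢
  simpa only [← hG, ← map_sub, norm_toL2] using hg

end FockSpace

/-- The maximal weighted composition operator `f ↦ ψ · (f ∘ φ)` on the Fock space, with domain
`{f ∈ F² : ψ · (f ∘ φ) ∈ F²}`. -/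
def maximalWCO (ψ φ : ℂ → ℂ) : FockSpace →ₗ.[ℂ] FockSpace where
  domain :=
    { carrier := {f | (fun z => ψ z * f (φ z)) ∈ fockSubmodule}
      zero_mem' := by
        change (fun z => ψ z * (0 : ℂ)) ∈ fockSubmodule
        simp only [mul_zero]
        exact fockSubmodule.zero_mem
      add_mem' := fun {f g} hf hg => by
        change (fun z => ψ z * (f (φ z) + g (φ z))) ∈ fockSubmodule
        simp only [mul_add]
        exact fockSubmodule.add_mem hf hg
      smul_mem' := fun c f hf => by
        change (fun z => ψ z * (c * f (φ z))) ∈ fockSubmodule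
        simp only [mul_left_comm]
        exact fockSubmodule.smul_mem c hf }
  toFun :=
    { toFun := fun f => FockSpace.mk (fun z => ψ z * f.1 (φ z)) f.2
      map_add' := fun f g => FockSpace.ext' fun z => mul_add (ψ z) (f.1 (φ z)) (g.1 (φ z))
      map_smul' := fun c f => FockSpace.ext' fun z => mul_left_comm (ψ z) c (f.1 (φ z)) }

/-- `W` is a (not necessarily bounded) weighted composition operator with symbols `ψ`, `φ`: it is a
restriction of the maximal one to some linear subspace. -/
def IsWCO (ψ φ : ℂ → ℂ) (W : FockSpace →ₗ.[ℂ] FockSpace) : Prop :=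
  W ≤ maximalWCO ψ φ

end

/-! Everything rests on the reproducing kernels `K_w(z) = exp(conj w * z)`, for which `W* K_w = conj
(ψ w) K_{φ w}`. The operator `W` is injective because `φ` is open and `ψ ≢ 0`. If `W* f = 0`, the
norm inequality gives `W (S f) = 0`, so `S f = 0`; the same applies to `0`, and an involution is
injective, so `f = 0`. Thus `W*` is injective. A zero of `ψ`, or a coincidence `φ u = φ v` with `u ≠
v`, would put a nonzero combination of kernels in the null space of `W*`. Hence `ψ` is zero-free and
`φ` is injective, so affine.

A zero-free `f` in the Fock space satisfies `|f z| ≤ ‖f‖ exp(|z|²/2)`, so its logarithm is a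
polynomial of degree at most two (`Differentiable.exists_eq_exp_quadratic`). The quadratic
coefficient is less than `1/2` in modulus because `|f z|² exp(-|z|²)` tends to zero at infinity.

For `S = id` and `φ z = z + B`, every kernel lies in the domain of `W`. Comparing `W K_w` at `w + h`
with `‖W* K_w‖` gives an inequality of exponents, real-affine in `w`, which kills the quadratic
coefficient and bounds `D`. -/

/-! ### Entire functions: growth, zeros, injectivity. -/

/-- An entire function of polynomial growth of degree `n` is a polynomial of degree at most `n`. -/
theorem Differentiable.exists_polynomial_of_norm_le {f : ℂ → ℂ} (hf : Differentiable ℂ f) {n : ℕ}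
    {C : ℝ} (hC : ∀ z, 1 ≤ ‖z‖ → ‖f z‖ ≤ C * ‖z‖ ^ n) :
    ∃ a : ℕ → ℂ, ∀ z, f z = ∑ k ∈ Finset.range (n + 1), a k * z ^ k := by
  have hz : ∀ k, n < k → iteratedDeriv k f 0 = 0 := by
    intro k hk
    -- Cauchy's estimate on the circle of radius `R`; since `k > n`, the bound vanishes as `R → ∞`.
    have hb : ∀ᶠ R : ℝ in atTop, ‖iteratedDeriv k f 0‖ ≤ k.factorial * C / R ^ (k - n) := by
      filter_upwards [eventually_ge_atTop 1] with R hR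
      have h1 := norm_iteratedDeriv_le_of_forall_mem_sphere_norm_le (c := 0) (C := C * R ^ n) k
        (by linarith : 0 < R) hf.diffContOnCl fun z hz => by
          have h2 : ‖z‖ = R := by simpa using hz
          rw [← h2]
          exact hC z (by linarith)
      refine h1.trans (le_of_eq ?_)
      have h2 : R ^ k = R ^ n * R ^ (k - n) := by
        rw [← pow_add]
        congr 1
        omega
      have : R ≠ 0 := by linarith
      rw [h2]
      field_simp
    have hlim : Tendsto (fun R : ℝ => k.factorial * C / R ^ (k - n)) atTop (𝓝 0) :=
      tendsto_const_nhds.div_atTop (tendsto_pow_atTop (by omega))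
    exact norm_le_zero_iff.1 (ge_of_tendsto hlim hb)
  refine ⟨fun k => (k.factorial : ℂ)⁻¹ * iteratedDeriv k f 0, fun z => ?_⟩
  rw [← Complex.taylorSeries_eq_of_entire' 0 z hf, tsum_eq_sum (s := Finset.range (n + 1))]
  · simp
  · intro k hk
    rw [hz k (by simpa using hk)]
    simp

/-- An entire function without zeros has an entire logarithm. -/
theorem Differentiable.exists_eq_exp {f : ℂ → ℂ} (hf : Differentiable ℂ f) (h0 : ∀ z, f z ≠ 0) :
    ∃ g : ℂ → ℂ, Differentiable ℂ g ∧ ∀ z, f z = Complex.exp (g z) := by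
  -- A primitive `g` of `f'/f` makes `f * exp(-g)` constant; it remains to adjust `g` by a constant.
  obtain ⟨g, hg⟩ := (hf.deriv.div hf h0).isExactOn_univ
  have hg' : ∀ z, HasDerivAt g (_root_.deriv f z / f z) z := fun z => hg z trivial
  have hd : Differentiable ℂ fun z => f z * Complex.exp (-g z) := fun z =>
    (hf z).mul (hg' z).differentiableAt.neg.cexp
  have hc : ∀ z, f z * Complex.exp (-g z) = f 0 * Complex.exp (-g 0) := fun z => by
    refine is_const_of_deriv_eq_zero hd (fun z => ?_) z 0
    refine ((hf z).hasDerivAt.mul (hg' z).neg.cexp).deriv.trans ?_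
    simp only [Pi.neg_apply]
    have := h0 z
    field_simp
    ring
  refine ⟨fun z => g z + (Complex.log (f 0) - g 0), fun z =>
    (hg' z).differentiableAt.add_const _, fun z => ?_⟩
  have h1 := hc z
  rw [Complex.exp_neg, Complex.exp_neg] at h1
  rw [Complex.exp_add, Complex.exp_sub, Complex.exp_log (h0 0)]
  have := Complex.exp_ne_zero (g z)
  have := Complex.exp_ne_zero (g 0)
  field_simp at h1 ⊢
  linear_combination h1

/-- An entire function without zeros and with at most Gaussian growth is the exponential of a
polynomial of degree at most two. -/
theorem Differentiable.exists_eq_exp_quadratic {f : ℂ → ℂ} (hf : Differentiable ℂ f)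
    (h0 : ∀ z, f z ≠ 0) {M b : ℝ} (hM : ∀ z, ‖f z‖ ≤ M * Real.exp (b * ‖z‖ ^ 2)) :
    ∃ C D : ℂ, ∀ z, f z = f 0 * Complex.exp (C * z ^ 2 + D * z) := by
  obtain ⟨g, hg, hfg⟩ := hf.exists_eq_exp h0
  have hMpos : 0 < M := by
    have h1 := (norm_pos_iff.2 (h0 0)).trans_le (hM 0)
    simpa using h1
  have hre : ∀ z, (g z).re ≤ Real.log M + b * ‖z‖ ^ 2 := by
    intro z
    have h1 := hM z
    rw [hfg, Complex.norm_exp] at h1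
    rw [← Real.exp_le_exp, Real.exp_add, Real.exp_log hMpos]
    exact h1
  obtain ⟨a, ha⟩ := hg.exists_polynomial_of_norm_le (n := 2)
    (C := 2 * (|Real.log M| + 1 + 4 * |b|) + 3 * ‖g 0‖) fun z hz => by
      have hz0 : 0 < ‖z‖ := by linarith
      -- With `r = ‖z‖` and `R = 2r`, the factors `2r/(R-r)` and `(R+r)/(R-r)` are `2` and `3`. The
      -- summand `1` keeps the bound on the real part positive.
      have h1 := Complex.borelCaratheodory (f := g) (R := 2 * ‖z‖) (z := z)
        (M := |Real.log M| + 1 + 4 * |b| * ‖z‖ ^ 2) (by positivity) hg.differentiableOn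
        (fun w hw => by
          have hw' : ‖w‖ < 2 * ‖z‖ := by simpa using hw
          have h2 := hre w
          have h3 : b * ‖w‖ ^ 2 ≤ |b| * (2 * ‖z‖) ^ 2 := by
            gcongr
            exact le_abs_self b
          have h4 := le_abs_self (Real.log M)
          change (g w).re ≤ _
          nlinarith)
        (by positivity) (by rw [mem_ball_zero_iff]; linarith)
      have e1 : 2 * ‖z‖ - ‖z‖ = ‖z‖ := by ring
      have e2 : 2 * ‖z‖ + ‖z‖ = 3 * ‖z‖ := by ring
      rw [e1, e2, mul_div_assoc, div_self hz0.ne', mul_one, ← mul_assoc, mul_div_assoc,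
        div_self hz0.ne', mul_one] at h1
      have h5 : 1 ≤ ‖z‖ ^ 2 := one_le_pow₀ hz
      have h6 := abs_nonneg (Real.log M)
      have h7 := norm_nonneg (g 0)
      nlinarith
  refine ⟨a 2, a 1, fun z => ?_⟩
  rw [hfg, hfg, ← Complex.exp_add]
  congr 1
  rw [ha z, ha 0]
  simp [Finset.sum_range_succ]
  ring

/-- An entire polynomial without zeros is constant. -/
theorem eq_const_of_polynomial_ne_zero {f : ℂ → ℂ} (p : Polynomial ℂ) (hp : ∀ z, f z = p.eval z)
    (h0 : ∀ z, f z ≠ 0) : ∃ c, ∀ z, f z = c := by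
  by_cases hd : p.degree = 0
  · rw [Polynomial.eq_C_of_degree_eq_zero hd] at hp
    exact ⟨_, fun z => by rw [hp, Polynomial.eval_C]⟩
  · obtain ⟨z, hz⟩ := Complex.exists_root (f := p) (by
      refine lt_of_le_of_ne ?_ (Ne.symm hd)
      rw [Polynomial.zero_le_degree_iff]
      rintro rfl
      exact h0 0 (by simp [hp]))
    exact absurd ((hp z).trans hz) (h0 z)

/-- An entire function, not identically zero, vanishing at most at `0` is `z ^ n` times an entire
function without zeros. -/
theorem Differentiable.exists_eq_pow_mul {f : ℂ → ℂ} (hf : Differentiable ℂ f)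
    (h0 : ∀ z, z ≠ 0 → f z ≠ 0) :
    ∃ (n : ℕ) (g : ℂ → ℂ), Differentiable ℂ g ∧ (∀ z, g z ≠ 0) ∧ ∀ z, f z = z ^ n * g z := by
  have han : AnalyticAt ℂ f 0 := hf.analyticAt 0
  have hne : ¬ ∀ᶠ z in 𝓝 0, f z = 0 := by
    intro h
    obtain ⟨z, hz, hz0⟩ := ((h.filter_mono nhdsWithin_le_nhds).and
      (self_mem_nhdsWithin (a := (0 : ℂ)) (s := {0}ᶜ))).exists
    exact h0 z hz0 hz
  obtain ⟨n, k, hk, hk0, hfk⟩ := han.exists_eventuallyEq_pow_smul_nonzero_iff.2 hne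
  simp only [sub_zero, smul_eq_mul] at hfk
  classical
  -- The value at `0` comes from the local factorization, which removes the singularity of `f z / z
  -- ^ n`.
  let g : ℂ → ℂ := fun z => if z = 0 then k 0 else f z / z ^ n
  have hgk : g =ᶠ[𝓝 0] k := by
    filter_upwards [hfk] with z hz
    by_cases h : z = 0
    · simp [g, h]
    · simp only [g, h, if_false]
      rw [hz]
      field_simp
  refine ⟨n, g, fun z => ?_, fun z => ?_, fun z => ?_⟩
  · by_cases h : z = 0
    · rw [h]
      exact hk.differentiableAt.congr_of_eventuallyEq hgk
    · have h1 : g =ᶠ[𝓝 z] fun z => f z / z ^ n := by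
        filter_upwards [isOpen_ne.mem_nhds h] with w hw
        simp [g, hw]
      exact ((hf z).div (differentiableAt_id.pow n) (pow_ne_zero n h)).congr_of_eventuallyEq h1
  · by_cases h : z = 0
    · simpa [g, h] using hk0
    · simpa [g, h] using h0 z h
  · by_cases h : z = 0
    · rw [h, hfk.self_of_nhds]
      simp [g]
    · simp only [g, h, if_false]
      field_simp

/-- An injective entire function is affine. -/
theorem Differentiable.exists_affine_of_injective {f : ℂ → ℂ} (hf : Differentiable ℂ f)
    (hinj : Function.Injective f) : ∃ A B : ℂ, A ≠ 0 ∧ ∀ z, f z = A * z + B := by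
  have hd : Differentiable ℂ fun z => f z - f 0 := hf.sub_const _
  obtain ⟨n, g, hg, hg0, hfg⟩ := hd.exists_eq_pow_mul fun z hz h =>
    hz (hinj (sub_eq_zero.1 h))
  -- By openness the image of the unit disc contains a disc about `f 0`; by injectivity no point
  -- outside the unit disc is mapped there.
  obtain ⟨ε, hε, hball⟩ : ∃ ε > 0, ∀ z, 1 ≤ ‖z‖ → ε ≤ ‖f z - f 0‖ := by
    have hopen : IsOpenMap f := by
      refine ((hf.differentiableOn.analyticOnNhd isOpen_univ).is_constant_or_isOpenMap).resolve_left
        ?_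
      rintro ⟨w, hw⟩
      exact one_ne_zero (hinj ((hw 1).trans (hw 0).symm))
    obtain ⟨ε, hε, h⟩ := Metric.isOpen_iff.1 (hopen _ (Metric.isOpen_ball (x := (0 : ℂ)) (ε := 1)))
      (f 0) ⟨0, by simp, rfl⟩
    refine ⟨ε, hε, fun z hz => ?_⟩
    by_contra! hlt
    obtain ⟨w, hw, hwz⟩ := h (show f z ∈ Metric.ball (f 0) ε by rwa [mem_ball_iff_norm])
    rw [hinj hwz] at hw
    exact absurd (mem_ball_zero_iff.1 hw) (not_lt.2 hz)
  -- The lower bound gives `|1/g| ≤ |z|^n / ε`, so `1/g` is a zero-free polynomial, hence constant.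
  obtain ⟨a, ha⟩ := (hg.inv hg0).exists_polynomial_of_norm_le (n := n) (C := ε⁻¹) fun z hz => by
    have h1 := hball z hz
    rw [hfg, norm_mul, norm_pow] at h1
    have h2 : 0 < ‖g z‖ := norm_pos_iff.2 (hg0 z)
    rw [Pi.inv_apply, norm_inv, inv_le_iff_one_le_mul₀ h2, mul_assoc, ← div_eq_inv_mul, one_le_div hε]
    exact h1
  obtain ⟨c, hc⟩ := eq_const_of_polynomial_ne_zero
    (∑ k ∈ Finset.range (n + 1), Polynomial.C (a k) * Polynomial.X ^ k)
    (fun z => by rw [← Pi.inv_apply, ha z]; simp [Polynomial.eval_finsetSum]) (fun z => inv_ne_zero (hg0 z))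
  have hc0 : c ≠ 0 := hc 0 ▸ inv_ne_zero (hg0 0)
  have hpow : ∀ z, f z = c⁻¹ * z ^ n + f 0 := fun z => by
    have h1 := hfg z
    have h2 := hc z
    rw [← h2, inv_inv]
    linear_combination h1
  have hn0 : n ≠ 0 := by
    rintro rfl
    refine one_ne_zero (hinj (?_ : f 1 = f 0))
    have h1 := hpow 0
    rw [hpow 1, pow_zero, ← pow_zero (0 : ℂ), ← h1]
  have hn : n = 1 := by
    -- A primitive `n`-th root of unity has the same image as `1`.
    have hζ := Complex.isPrimitiveRoot_exp n hn0
    rw [hζ.eq_orderOf, orderOf_eq_one_iff]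
    exact hinj (by rw [hpow, hζ.pow_eq_one, hpow 1, one_pow])
  exact ⟨c⁻¹, f 0, inv_ne_zero hc0, fun z => by rw [hpow, hn, pow_one]⟩

/-! ### Gaussian measure and the mean value property. -/

theorem integrable_gaussMeasure_iff {f : ℂ → ℂ} : Integrable f gaussMeasure ↔
    Integrable fun z => (Real.exp (-‖z‖ ^ 2) / Real.pi : ℝ) • f z := by
  rw [gaussMeasure, integrable_withDensity_iff_integrable_smul' (by fun_prop)
    (ae_of_all _ fun z => ENNReal.ofReal_lt_top)]
  refine integrable_congr (ae_of_all _ fun z => ?_)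
  simp only
  rw [ENNReal.toReal_ofReal (by positivity)]

theorem integral_gaussMeasure (f : ℂ → ℂ) : ∫ z, f z ∂gaussMeasure =
    ∫ z, (Real.exp (-‖z‖ ^ 2) / Real.pi : ℝ) • f z := by
  rw [gaussMeasure, integral_withDensity_eq_integral_toReal_smul (by fun_prop)
    (ae_of_all _ fun z => ENNReal.ofReal_lt_top)]
  refine integral_congr_ae (ae_of_all _ fun z => ?_)
  simp only
  rw [ENNReal.toReal_ofReal (by positivity)]

instance : IsProbabilityMeasure gaussMeasure := by
  have h1 := GaussianFourier.integral_rexp_neg_mul_sq_norm (V := ℂ) one_pos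
  have h3 : Integrable fun z : ℂ => Real.exp (-‖z‖ ^ 2) := by
    refine (not_imp_comm.1 integral_undef) ?_
    simp only [neg_mul, one_mul] at h1
    rw [h1]
    have := Real.pi_pos
    positivity
  constructor
  rw [gaussMeasure, withDensity_apply _ MeasurableSet.univ, setLIntegral_univ,
    ← ofReal_integral_eq_lintegral_ofReal (h3.div_const _)
      (ae_of_all _ fun z => by positivity), integral_div]
  simp only [neg_mul, one_mul] at h1
  rw [h1]
  simp [Complex.finrank_real_complex, Real.pi_ne_zero]

theorem measurePreserving_gaussMeasure_rotation (a : Circle) :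
    MeasurePreserving (fun z : ℂ => a * z) gaussMeasure gaussMeasure := by
  have h : MeasurePreserving (fun z : ℂ => a * z) volume volume :=
    (rotation a).measurePreserving
  have hm : Measurable fun z : ℂ => (a : ℂ) * z := by fun_prop
  refine ⟨hm, Measure.ext fun s hs => ?_⟩
  rw [Measure.map_apply hm hs, gaussMeasure, withDensity_apply _ (hm hs), withDensity_apply _ hs,
    ← h.setLIntegral_comp_preimage hs (by fun_prop)]
  simp [Circle.norm_coe]

/-- The mean value property of entire functions with respect to the Gaussian measure. -/
theorem Differentiable.integral_gaussMeasure_eq {f : ℂ → ℂ} (hf : Differentiable ℂ f)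
    (hi : Integrable f gaussMeasure) : ∫ z, f z ∂gaussMeasure = f 0 := by
  -- Rotation invariance and Fubini replace `f` by its averages over circles centred at `0`, all
  -- equal to `f 0`.
  have hrot : ∀ {E : Type} [NormedAddCommGroup E] [NormedSpace ℝ E] (g : ℂ → E),
      Integrable g gaussMeasure → ∀ θ : ℝ,
      Integrable (fun z => g (circleMap 0 1 θ * z)) gaussMeasure ∧
      ∫ z, g (circleMap 0 1 θ * z) ∂gaussMeasure = ∫ z, g z ∂gaussMeasure := by
    intro E _ _ g hg θ
    have h := measurePreserving_gaussMeasure_rotation (Circle.exp θ)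
    have e : (Circle.exp θ : ℂ) = circleMap 0 1 θ := by simp [circleMap]
    have hemb : MeasurableEmbedding fun z : ℂ => (Circle.exp θ : ℂ) * z :=
      (rotation (Circle.exp θ)).toHomeomorph.measurableEmbedding
    rw [e] at h hemb
    exact ⟨(h.integrable_comp_emb hemb).2 hg, h.integral_comp hemb g⟩
  have hcont : Continuous fun p : ℝ × ℂ => f (circleMap 0 1 p.1 * p.2) :=
    hf.continuous.comp (((continuous_circleMap 0 1).comp continuous_fst).mul continuous_snd)
  have hprod : Integrable (Function.uncurry fun (θ : ℝ) (z : ℂ) => f (circleMap 0 1 θ * z))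
      ((volume.restrict (Set.Ioc 0 (2 * Real.pi))).prod gaussMeasure) := by
    refine (integrable_prod_iff hcont.aestronglyMeasurable).2 ⟨ae_of_all _ fun θ =>
      (hrot f hi θ).1, ?_⟩
    have h1 : ∀ θ : ℝ, ∫ z, ‖f (circleMap 0 1 θ * z)‖ ∂gaussMeasure =
        ∫ z, ‖f z‖ ∂gaussMeasure := fun θ => (hrot (fun z => ‖f z‖) hi.norm θ).2
    simp only [h1]
    exact integrable_const _
  have hswap := integral_integral_swap hprod
  have hmean : ∀ z, ∫ θ in Set.Ioc 0 (2 * Real.pi), f (circleMap 0 1 θ * z) =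
      (2 * Real.pi : ℝ) • f 0 := by
    intro z
    have h1 : Real.circleAverage (fun u => f (u * z)) 0 1 = f (0 * z) :=
      DiffContOnCl.circleAverage (f := fun u => f (u * z))
        (hf.comp (differentiable_id.mul_const z)).diffContOnCl
    rw [zero_mul, Real.circleAverage_def,
      intervalIntegral.integral_of_le (by positivity)] at h1
    rw [← h1, smul_smul, mul_inv_cancel₀ (by positivity), one_smul]
  simp only [hmean, (hrot f hi _).2] at hswap
  rw [integral_const, integral_const, measureReal_restrict_apply_univ, Real.volume_real_Ioc_of_le
    (by positivity), probReal_univ, one_smul, sub_zero] at hswap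
  exact smul_right_injective _ (by positivity : (2 * Real.pi) ≠ 0) hswap

/-! ### Reproducing kernels and pointwise growth. -/

namespace FockSpace

theorem exp_mul_mem_fockSubmodule (a : ℂ) : (fun z => Complex.exp (a * z)) ∈ fockSubmodule := by
  refine ⟨by fun_prop, ?_⟩
  rw [memLp_two_iff_integrable_sq_norm (by fun_prop)]
  have h1 : Integrable (fun z => Complex.exp (a * z) * conj (Complex.exp (a * z))) gaussMeasure := by
    rw [integrable_gaussMeasure_iff]
    have h2 := (GaussianFourier.integrable_cexp_neg_mul_sq_norm_add (V := ℂ) (b := 1) (by simp) 2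
      (conj a)).const_mul ((Real.pi : ℂ)⁻¹)
    refine h2.congr (ae_of_all _ fun z => ?_)
    simp only [Complex.real_smul]
    have e : ((inner ℝ (conj a) z : ℝ) : ℂ) * 2 = a * z + conj (a * z) := by
      rw [Complex.add_conj, Complex.inner]
      simp
      ring
    rw [← Complex.exp_conj, ← Complex.exp_add, ← e]
    push_cast
    rw [Complex.exp_add]
    ring_nf
  refine h1.norm.congr (ae_of_all _ fun z => ?_)
  simp [sq]

/-- The reproducing kernel at `w`. -/
noncomputable def kernel (w : ℂ) : FockSpace := mk _ (exp_mul_mem_fockSubmodule (conj w))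

@[simp] theorem kernel_apply (w z : ℂ) : kernel w z = Complex.exp (conj w * z) := rfl

/-- Substituting `z = u + w` completes the square: the inner product becomes the Gaussian mean of
the entire function `exp(-conj w * u) * f (u + w)`, which is its value at `u = 0`. -/
theorem inner_kernel (w : ℂ) (f : FockSpace) : inner ℂ (kernel w) f = f w := by
  have hint : Integrable (fun z => conj (kernel w z) * f z) gaussMeasure :=
    ((kernel w).memLp.star).integrable_mul f.memLp
  have key : ∀ u : ℂ, (Real.exp (-‖u + w‖ ^ 2) / Real.pi : ℝ) • (conj (kernel w (u + w)) * f (u + w))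
      = (Real.exp (-‖u‖ ^ 2) / Real.pi : ℝ) • (Complex.exp (-(conj w * u)) * f (u + w)) := by
    intro u
    simp only [Complex.real_smul, kernel_apply, ← Complex.exp_conj]
    push_cast
    have e : Complex.exp (-(‖u + w‖ : ℂ) ^ 2) * Complex.exp (conj (conj w * (u + w))) =
        Complex.exp (-(‖u‖ : ℂ) ^ 2) * Complex.exp (-(conj w * u)) := by
      rw [← Complex.exp_add, ← Complex.exp_add, ← Complex.mul_conj', ← Complex.mul_conj']
      congr 1
      simp only [map_add, map_mul, Complex.conj_conj]
      ring
    linear_combination (f (u + w) / Real.pi) * e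
  rw [integrable_gaussMeasure_iff] at hint
  have hint' := hint.comp_add_right w
  simp only [key] at hint'
  rw [← integrable_gaussMeasure_iff] at hint'
  rw [inner_eq_integral, integral_gaussMeasure, ← integral_add_right_eq_self _ w]
  simp only [key]
  rw [← integral_gaussMeasure, Differentiable.integral_gaussMeasure_eq ?_ hint']
  · simp
  · have := f.differentiable
    fun_prop

theorem norm_kernel (w : ℂ) : ‖kernel w‖ = Real.exp (‖w‖ ^ 2 / 2) := by
  have h := inner_kernel w (kernel w)
  rw [inner_self_eq_norm_sq_to_K, kernel_apply, Complex.conj_mul'] at h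
  have h2 : ‖kernel w‖ ^ 2 = Real.exp (‖w‖ ^ 2) := by
    have h3 : ((‖kernel w‖ ^ 2 : ℝ) : ℂ) = (Real.exp (‖w‖ ^ 2) : ℝ) := by
      push_cast
      exact h
    exact_mod_cast h3
  rw [← sq_eq_sq₀ (norm_nonneg _) (Real.exp_pos _).le, h2, ← Real.exp_nat_mul]
  congr 1
  push_cast
  ring

/-- The sharp pointwise estimate in the Fock space. -/
theorem norm_apply_le (f : FockSpace) (z : ℂ) : ‖f z‖ ≤ ‖f‖ * Real.exp (‖z‖ ^ 2 / 2) := by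
  rw [← inner_kernel z f, mul_comm, ← norm_kernel]
  exact norm_inner_le_norm _ _

/-- Along a sequence tending to infinity, `|f z|² e^{-|z|²}` tends to zero. -/
theorem tendsto_sq_norm_mul_exp (f : FockSpace) {u : ℕ → ℂ}
    (hu : Tendsto (fun n => ‖u n‖) atTop atTop) :
    Tendsto (fun n => ‖f (u n)‖ₑ ^ 2 * ENNReal.ofReal (Real.exp (-‖u n‖ ^ 2))) atTop (𝓝 0) := by
  have hc := f.differentiable.continuous
  have hfin : ∫⁻ w, ‖f w‖ₑ ^ 2 ∂gaussMeasure ≠ ∞ := by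
    have h1 := f.memLp.2
    rw [eLpNorm_lt_top_iff_lintegral_rpow_enorm_lt_top (by norm_num) (by norm_num)] at h1
    simpa using h1.ne
  -- The unit discs about `u n` leave every bounded set, so the mass of `|f|²` on them tends to
  -- zero.
  have hlim : Tendsto (fun n => ∫⁻ w, (Metric.ball (u n) 1).indicator (fun w => ‖f w‖ₑ ^ 2) w
      ∂gaussMeasure) atTop (𝓝 (∫⁻ _, 0 ∂gaussMeasure)) := by
    refine tendsto_lintegral_of_dominated_convergence (fun w => ‖f w‖ₑ ^ 2) (fun n => ?_)
      (fun n => ae_of_all _ fun w => Set.indicator_le_self _ _ _) hfin (ae_of_all _ fun w => ?_)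
    · exact Measurable.indicator (by fun_prop) Metric.isOpen_ball.measurableSet
    · refine tendsto_const_nhds.congr' ?_
      filter_upwards [hu.eventually_ge_atTop (‖w‖ + 1)] with n hn
      rw [Set.indicator_of_notMem]
      rw [mem_ball_iff_norm']
      have := norm_sub_norm_le (u n) w
      linarith
  rw [lintegral_zero] at hlim
  have hlim2 := ENNReal.Tendsto.const_mul (a := ENNReal.ofReal (Real.exp 1)) hlim
    (Or.inr ENNReal.ofReal_ne_top)
  rw [mul_zero] at hlim2
  refine tendsto_of_tendsto_of_tendsto_of_le_of_le tendsto_const_nhds hlim2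
    (fun n => zero_le) fun n => ?_
  set z := u n
  -- The exponential factor is entire in `w` and has modulus `exp(-|w|²) exp(|w-z|²)`: it reproduces
  -- the Gaussian weight up to a factor at most `e` on the unit disc about `z`.
  have hsub := pi_mul_enorm_le (f := fun w => f w ^ 2 * Complex.exp (-(2 * conj z * w) + ‖z‖ ^ 2))
    (by have := f.differentiable; fun_prop) z
  have hnorm : ∀ w, ‖Complex.exp (-(2 * conj z * w) + (‖z‖ : ℂ) ^ 2)‖ =
      Real.exp (-‖w‖ ^ 2) * Real.exp (‖w - z‖ ^ 2) := by
    intro w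
    rw [Complex.norm_exp, ← Real.exp_add, ← Complex.normSq_eq_norm_sq, ← Complex.normSq_eq_norm_sq]
    congr 1
    rw [← Complex.ofReal_pow, ← Complex.normSq_eq_norm_sq]
    simp [Complex.normSq_apply]
    ring
  have hnormz : ‖f z ^ 2 * Complex.exp (-(2 * conj z * z) + (‖z‖ : ℂ) ^ 2)‖ₑ =
      ‖f z‖ₑ ^ 2 * ENNReal.ofReal (Real.exp (-‖z‖ ^ 2)) := by
    rw [enorm_mul, enorm_pow, ← ofReal_norm (Complex.exp _), hnorm]
    simp
  have hpi : ENNReal.ofReal Real.pi ≠ 0 := by simpa using Real.pi_pos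
  rw [hnormz] at hsub
  refine (ENNReal.mul_le_mul_iff_right hpi ENNReal.ofReal_ne_top).1 (hsub.trans ?_)
  rw [lintegral_indicator Metric.isOpen_ball.measurableSet, gaussMeasure,
    setLIntegral_withDensity_eq_setLIntegral_mul _ (by fun_prop) (by fun_prop)
      Metric.isOpen_ball.measurableSet, ← lintegral_const_mul _ (by fun_prop),
    ← lintegral_const_mul _ (by fun_prop)]
  refine setLIntegral_mono' Metric.isOpen_ball.measurableSet fun w hw => ?_
  rw [enorm_mul, enorm_pow, ← ofReal_norm (Complex.exp _), hnorm, Pi.mul_apply, ← mul_assoc,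
    ← mul_assoc, mul_comm]
  gcongr
  rw [← ENNReal.ofReal_mul (by positivity), ← ENNReal.ofReal_mul (by positivity)]
  refine ENNReal.ofReal_le_ofReal ?_
  have hw1 : ‖w - z‖ ^ 2 ≤ 1 := by
    rw [mem_ball_iff_norm] at hw
    exact pow_le_one₀ (norm_nonneg _) hw.le
  have hpi' := Real.pi_pos
  calc Real.exp (-‖w‖ ^ 2) * Real.exp (‖w - z‖ ^ 2)
      ≤ Real.exp (-‖w‖ ^ 2) * Real.exp 1 := by gcongr
    _ = _ := by field_simp

end FockSpace

/-! ### Zero-free functions and independence of kernels. -/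

namespace FockSpace

/-- A Gaussian in the Fock space has quadratic coefficient of modulus less than `1 / 2`. -/
theorem norm_lt_half_of_eq_exp_quadratic (f : FockSpace) (h0 : f 0 ≠ 0) {C D : ℂ}
    (hf : ∀ z, f z = f 0 * Complex.exp (C * z ^ 2 + D * z)) : ‖C‖ < 1 / 2 := by
  by_contra! hC
  have hC0 : (‖C‖ : ℂ) ≠ 0 := by
    have : 0 < ‖C‖ := by linarith
    exact_mod_cast this.ne'
  -- Along the ray through `u` the quadratic term grows fastest; the sign of `u` is free and makes
  -- the linear term harmless. If `|C| ≥ 1/2`, then `|f|² exp(-|z|²) ≥ |f 0|²` there, contradicting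
  -- decay.
  obtain ⟨u, hu1, hCu, hDu⟩ : ∃ u : ℂ, ‖u‖ = 1 ∧ C * u ^ 2 = ‖C‖ ∧ 0 ≤ (D * u).re := by
    obtain ⟨v, hv⟩ := IsAlgClosed.exists_pow_nat_eq (conj C / ‖C‖) two_pos
    have hv1 : ‖v‖ = 1 := by
      rw [← pow_eq_one_iff_of_nonneg (norm_nonneg v) two_ne_zero, ← norm_pow, hv, norm_div,
        Complex.norm_conj, Complex.norm_real, norm_norm, div_self (by exact_mod_cast hC0)]
    have hCv : C * v ^ 2 = ‖C‖ := by
      rw [hv, ← mul_div_assoc, Complex.mul_conj', sq, mul_div_assoc, div_self hC0, mul_one]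
    rcases le_total 0 (D * v).re with h | h
    · exact ⟨v, hv1, hCv, h⟩
    · exact ⟨-v, by rwa [norm_neg], by rwa [neg_sq], by rw [mul_neg, Complex.neg_re]; linarith⟩
  have hnorm : ∀ n : ℕ, ‖(n : ℂ) * u‖ = n := fun n => by simp [hu1]
  have hlim := f.tendsto_sq_norm_mul_exp (u := fun n => n * u) (by
    simp only [hnorm]
    exact tendsto_natCast_atTop_atTop)
  have hle : ‖f 0‖ₑ ^ 2 ≤ 0 := by
    refine ge_of_tendsto' hlim fun n => ?_
    rw [hnorm, ← ofReal_norm, ← ofReal_norm, ← ENNReal.ofReal_pow (norm_nonneg _),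
      ← ENNReal.ofReal_pow (norm_nonneg _), ← ENNReal.ofReal_mul (by positivity)]
    refine ENNReal.ofReal_le_ofReal ?_
    rw [hf (n * u), norm_mul, Complex.norm_exp, mul_pow, mul_assoc, ← Real.exp_nat_mul,
      ← Real.exp_add]
    refine le_mul_of_one_le_right (by positivity) (Real.one_le_exp ?_)
    have e : C * (n * u) ^ 2 + D * (n * u) = ((n ^ 2 * ‖C‖ : ℝ) : ℂ) + (n : ℝ) * (D * u) := by
      push_cast
      rw [← hCu]
      ring
    rw [e, Complex.add_re, Complex.ofReal_re, Complex.re_ofReal_mul]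
    have h1 : 0 ≤ (n : ℝ) * (D * u).re := by positivity
    have h2 : (n : ℝ) ^ 2 * (1 / 2) ≤ n ^ 2 * ‖C‖ := by gcongr
    push_cast
    linarith
  exact h0 (by simpa using hle)

theorem eq_exp_quadratic (f : FockSpace) (h0 : ∀ z, f z ≠ 0) :
    ∃ C D : ℂ, ‖C‖ < 1 / 2 ∧ ∀ z, f z = f 0 * Complex.exp (C * z ^ 2 + D * z) := by
  obtain ⟨C, D, h⟩ := f.differentiable.exists_eq_exp_quadratic h0 (M := ‖f‖) (b := 1 / 2)
    fun z => by
      rw [one_div_mul_eq_div]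
      exact f.norm_apply_le z
  exact ⟨C, D, f.norm_lt_half_of_eq_exp_quadratic (h0 0) h, h⟩

theorem kernel_ne_zero (w : ℂ) : kernel w ≠ 0 := fun h => by
  have := norm_kernel w
  rw [h, norm_zero] at this
  exact (Real.exp_pos _).ne this

/-- Reproducing kernels at two distinct points are linearly independent. -/
theorem smul_kernel_sub_smul_kernel_ne_zero {u v : ℂ} (huv : u ≠ v) {a b : ℂ} (ha : a ≠ 0) :
    a • kernel u - b • kernel v ≠ 0 := by
  intro h
  have h0 := congrArg (fun f : FockSpace => f 0) h
  simp only [sub_apply, smul_apply, kernel_apply, mul_zero, Complex.exp_zero, mul_one,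
    zero_apply] at h0
  obtain rfl : a = b := sub_eq_zero.1 h0
  have h1 : kernel u = kernel v := by
    rw [← smul_sub, smul_eq_zero, sub_eq_zero] at h
    exact h.resolve_left ha
  -- The derivative at `0` recovers the point from its kernel.
  have hd : ∀ w, deriv (kernel w) 0 = conj w := fun w => by
    have h3 : HasDerivAt (fun z => Complex.exp (conj w * z)) (Complex.exp (conj w * 0) *
        (conj w * 1)) 0 := ((hasDerivAt_id (0 : ℂ)).const_mul (conj w)).cexp
    refine h3.deriv.trans ?_
    simp
  exact huv (star_injective ((hd u).symm.trans ((congrArg (fun f : FockSpace => deriv f 0) h1).trans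
    (hd v))))

end FockSpace

open FockSpace

/-! ### Weighted composition operators and their adjoints. -/

namespace IsWCO

variable {ψ φ : ℂ → ℂ} {W : FockSpace →ₗ.[ℂ] FockSpace}

theorem apply_apply (hW : IsWCO ψ φ W) (f : W.domain) (z : ℂ) :
    W f z = ψ z * (f : FockSpace) (φ z) := by
  have h := hW.2 (x := f) (y := ⟨f, hW.1 f.2⟩) rfl
  rw [h]
  rfl

/-- A weighted composition operator with `ψ ≢ 0` and `φ` nonconstant is injective. -/
theorem eq_zero_of_apply_eq_zero (hW : IsWCO ψ φ W) (hψ : Differentiable ℂ ψ)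
    (hφ : Differentiable ℂ φ) (hψ0 : ∃ z, ψ z ≠ 0) (hφc : ¬ ∃ c, ∀ z, φ z = c) (f : W.domain)
    (hf : W f = 0) : (f : FockSpace) = 0 := by
  obtain ⟨z₀, hz₀⟩ := hψ0
  have hfd := (f : FockSpace).differentiable
  have hopen : IsOpenMap φ :=
    (hφ.differentiableOn.analyticOnNhd isOpen_univ).is_constant_or_isOpenMap.resolve_left hφc
  -- Near `z₀` the factor `ψ` can be cancelled; openness of `φ` then makes `f` vanish on a
  -- neighbourhood of `φ z₀`.
  have hev : ∀ᶠ z in 𝓝 z₀, (f : FockSpace) (φ z) = 0 := by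
    filter_upwards [hψ.continuous.continuousAt.eventually_ne hz₀] with z hz
    have h := hW.apply_apply f z
    rw [hf, zero_apply] at h
    exact (mul_eq_zero.1 h.symm).resolve_left hz
  have hev' : (f : FockSpace).toFun =ᶠ[𝓝 (φ z₀)] fun _ => 0 :=
    hopen.nhds_le z₀ (Filter.mem_map.2 hev)
  have := (hfd.differentiableOn.analyticOnNhd isOpen_univ).eq_of_eventuallyEq
    (analyticOnNhd_const (v := (0 : ℂ))) hev'
  exact ext' fun z => congrFun this z

theorem inner_kernel_apply (hW : IsWCO ψ φ W) (w : ℂ) (f : W.domain) :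
    inner ℂ (conj (ψ w) • kernel (φ w)) (f : FockSpace) = inner ℂ (kernel w) (W f) := by
  rw [inner_smul_left, inner_kernel, inner_kernel, hW.apply_apply, Complex.conj_conj]

theorem kernel_mem_adjoint_domain (hW : IsWCO ψ φ W) (w : ℂ) : kernel w ∈ W†.domain :=
  LinearPMap.mem_adjoint_domain_of_exists _ ⟨_, hW.inner_kernel_apply w⟩

theorem adjoint_kernel (hW : IsWCO ψ φ W) (hd : Dense (W.domain : Set FockSpace)) (w : ℂ) :
    W† ⟨kernel w, hW.kernel_mem_adjoint_domain w⟩ = conj (ψ w) • kernel (φ w) :=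
  LinearPMap.adjoint_apply_eq hd _ (hW.inner_kernel_apply w)

/-- If `W*` is injective, then `ψ` has no zeros. -/
theorem ne_zero_of_adjoint_injective (hW : IsWCO ψ φ W) (hd : Dense (W.domain : Set FockSpace))
    (hinj : ∀ f : W†.domain, W† f = 0 → (f : FockSpace) = 0) (z : ℂ) : ψ z ≠ 0 := by
  intro h
  refine kernel_ne_zero z (hinj ⟨kernel z, hW.kernel_mem_adjoint_domain z⟩ ?_)
  rw [hW.adjoint_kernel hd, h, map_zero, zero_smul]

/-- If `W*` is injective, then so is `φ`. -/
theorem injective_of_adjoint_injective (hW : IsWCO ψ φ W) (hd : Dense (W.domain : Set FockSpace))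
    (hinj : ∀ f : W†.domain, W† f = 0 → (f : FockSpace) = 0) : Function.Injective φ := by
  intro u v huv
  by_contra hne
  have h0 := hW.ne_zero_of_adjoint_injective hd hinj
  refine smul_kernel_sub_smul_kernel_ne_zero hne (a := conj (ψ v)) (b := conj (ψ u))
    (by simpa using h0 v) (hinj (conj (ψ v) • ⟨kernel u, hW.kernel_mem_adjoint_domain u⟩ -
      conj (ψ u) • ⟨kernel v, hW.kernel_mem_adjoint_domain v⟩) ?_)
  rw [LinearPMap.map_sub, LinearPMap.map_smul, LinearPMap.map_smul, hW.adjoint_kernel hd,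
    hW.adjoint_kernel hd, huv, smul_smul, smul_smul, mul_comm, sub_self]

end IsWCO

/-! ### Translations, and the main theorem. -/

/-- If `‖W K_w‖ ≤ ‖W* K_w‖` for all reproducing kernels, where `W` has symbols `ψ` and `z + B`,
then `ψ` is a multiple of `e^{Dz}` with `|D| ≤ |B|`. -/
theorem IsWCO.eq_exp_of_translation {ψ φ : ℂ → ℂ} {W : FockSpace →ₗ.[ℂ] FockSpace}
    (hW : IsWCO ψ φ W) {B : ℂ} (hφ : ∀ z, φ z = z + B) (h0 : ∀ z, ψ z ≠ 0)
    (hdom : ∀ w, kernel w ∈ W.domain)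
    (hle : ∀ w, ‖W ⟨kernel w, hdom w⟩‖ ≤ ‖conj (ψ w) • kernel (φ w)‖) :
    ∃ D : ℂ, (∀ z, ψ z = ψ 0 * Complex.exp (D * z)) ∧ ‖D‖ ≤ ‖B‖ := by
  -- Since `K_0 = 1`, `ψ = W K_0` lies in the Fock space.
  have hW0 : ∀ z, W ⟨kernel 0, hdom 0⟩ z = ψ z := fun z => by simp [hW.apply_apply]
  obtain ⟨C, D, -, hψ⟩ := eq_exp_quadratic (W ⟨kernel 0, hdom 0⟩) fun z => by
    rw [hW0]
    exact h0 z
  simp only [hW0] at hψ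
  -- Logarithm of the sharp pointwise bound for `W K_w` at `w + h`; all terms quadratic in `w`
  -- cancel.
  have key : ∀ h w : ℂ, (C * (h * (2 * w + h))).re + (D * h).re - ‖h‖ ^ 2 / 2 ≤ ‖B‖ ^ 2 / 2 := by
    intro h w
    have h1 := (norm_apply_le (W ⟨kernel w, hdom w⟩) (w + h)).trans
      (mul_le_mul_of_nonneg_right (hle w) (Real.exp_pos _).le)
    rw [hW.apply_apply, hφ, hφ, norm_smul, norm_kernel, Complex.norm_conj, norm_mul, kernel_apply,
      Complex.norm_exp, hψ, hψ w, norm_mul, norm_mul, Complex.norm_exp, Complex.norm_exp,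
      mul_assoc, mul_assoc, mul_assoc, mul_le_mul_iff_right₀ (norm_pos_iff.2 (h0 0)),
      ← Real.exp_add, ← Real.exp_add, ← Real.exp_add, Real.exp_le_exp,
      ← Complex.normSq_eq_norm_sq, ← Complex.normSq_eq_norm_sq] at h1
    rw [← Complex.normSq_eq_norm_sq, ← Complex.normSq_eq_norm_sq]
    simp only [Complex.normSq_apply, Complex.add_re, Complex.add_im, Complex.mul_re,
      Complex.mul_im, Complex.conj_re, Complex.conj_im, sq, Complex.re_ofNat, Complex.im_ofNat]
      at h1 ⊢
    linarith
  have hC : C = 0 := by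
    by_contra hC
    obtain ⟨t, ht⟩ := exists_gt (‖B‖ ^ 2 / 2 + 1 / 2 - C.re - D.re)
    -- This `w` turns `2Cw` into the arbitrarily large real `t`.
    have h1 := key 1 (t / (2 * C))
    have e : C * (1 * (2 * (t / (2 * C)) + 1)) = t + C := by
      field_simp
    rw [e] at h1
    simp only [Complex.add_re, Complex.ofReal_re, mul_one, norm_one] at h1
    linarith
  refine ⟨D, fun z => by rw [hψ z, hC, zero_mul, zero_add], ?_⟩
  -- The choice `h = conj D` maximizes `Re (D h) - |h|²/2`, with value `|D|²/2`.
  have h1 := key (conj D) 0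
  rw [hC, zero_mul, Complex.zero_re, Complex.mul_conj, Complex.ofReal_re, Complex.norm_conj,
    Complex.normSq_eq_norm_sq] at h1
  exact le_of_sq_le_sq (by linarith) (norm_nonneg _)

theorem theorem3p3 (ψ φ : ℂ → ℂ) (hψ : Differentiable ℂ ψ) (hφ : Differentiable ℂ φ)
    (hψ0 : ∃ z, ψ z ≠ 0) (hφc : ¬ ∃ c, ∀ z, φ z = c)
    (W : FockSpace →ₗ.[ℂ] FockSpace) (hW : IsWCO ψ φ W)
    (hdense : Dense (W.domain : Set FockSpace))
    (S : FockSpace → FockSpace) (hS : Function.Involutive S)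
    (hdom : ∀ f : FockSpace, f ∈ W†.domain → S f ∈ W.domain)
    (hle : ∀ (f : FockSpace) (hf : f ∈ W†.domain), ‖W ⟨S f, hdom f hf⟩‖ ≤ ‖W† ⟨f, hf⟩‖) :
    (∀ z, ψ z ≠ 0) ∧
    (ψ ∈ fockSubmodule → ∃ C D : ℂ, ‖C‖ < 1 / 2 ∧ ψ 0 ≠ 0 ∧
      ∀ z, ψ z = ψ 0 * Complex.exp (C * z ^ 2 + D * z)) ∧
    (∃ A B : ℂ, A ≠ 0 ∧ (∀ z, φ z = A * z + B) ∧
      (A = 1 → (∀ f, S f = f) → ∃ D : ℂ, ψ 0 ≠ 0 ∧ (∀ z, ψ z = ψ 0 * Complex.exp (D * z)) ∧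
        ‖D‖ ≤ ‖B‖)) := by
  have hS0 : ∀ f : W†.domain, W† f = 0 → S f = 0 := fun f hf => by
    refine hW.eq_zero_of_apply_eq_zero hψ hφ hψ0 hφc ⟨S f, hdom f f.2⟩ (norm_le_zero_iff.1 ?_)
    refine (hle f f.2).trans (le_of_eq ?_)
    rw [Subtype.coe_eta, hf, norm_zero]
  -- As `S` need not be linear, `S 0 = 0` is itself obtained from `hS0` at `0`.
  have hinj : ∀ f : W†.domain, W† f = 0 → (f : FockSpace) = 0 := fun f hf =>
    hS.injective ((hS0 f hf).trans (hS0 0 (LinearPMap.map_zero _)).symm)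
  have h0 := hW.ne_zero_of_adjoint_injective hdense hinj
  obtain ⟨A, B, hA, hAB⟩ :=
    hφ.exists_affine_of_injective (hW.injective_of_adjoint_injective hdense hinj)
  refine ⟨h0, fun hmem => ?_, A, B, hA, hAB, fun hA1 hSid => ?_⟩
  · obtain ⟨C, D, hC, h⟩ := eq_exp_quadratic (mk ψ hmem) h0
    exact ⟨C, D, hC, h0 0, h⟩
  · obtain rfl : S = id := funext hSid
    obtain ⟨D, hD, hDB⟩ := hW.eq_exp_of_translation (B := B) (fun z => by rw [hAB, hA1, one_mul]) h0
      (fun w => hdom _ (hW.kernel_mem_adjoint_domain w)) fun w => by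
        rw [← hW.adjoint_kernel hdense]
        exact hle _ _
    exact ⟨D, h0 0, hD, hDB⟩
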